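/- Let $k$ be a field of characteristic different from $2$ and $3$, and let $E_1\colon y^2=x^3+ax+b$ and $E_2\colon y^2=x^3+a'x+b'$ be elliptic curves over $k$ (with $a,b,a',b'\in k$ and nonzero discriminants). An isogeny $E_1\to E_2$ over $k$ is a morphism over $k$ that maps the point at infinity $O$ of $E_1$ to that of $E_2$; the constant map $0$ is included, and isogenies are added pointwise using the group law of $E_2$. The degree $d(\varphi)$ of a nonzero isogeny $\varphi$ is the degree of the field extension $k(E_1)/\varphi^*k(E_2)$ of function fields, and $d(0)=0$. Then for all isogenies $\varphi,\psi\colon E_1\to E_2$ over $k$, $$d(\varphi+\psi)+d(\varphi-\psi)=2d(\varphi)+2d(\psi).$$ -/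

import Mathlib

open WeierstrassCurve Polynomial WithZero
open scoped Polynomial.Bivariate

noncomputable section

/-! Elliptic curves over a field `k`: the place at the point at infinity `O`, isogenies defined
over `k`, and their degree. -/

namespace EllIsog

variable {k : Type*} [Field k]

/-- The function field `k(E)` of a Weierstrass curve `E` over `k`. -/
abbrev FF (E : WeierstrassCurve k) := E.toAffine.FunctionField

instance (E : WeierstrassCurve k) : DecidableEq (FF E) := Classical.decEq _

/-- Minus the order at `O` of a function `f` in the coordinate ring `k[x, y]`, written as an
exponent: the order of the pole of `f` at `O` is the degree in `x` of the norm of `f` to `k[x]`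
(so `x` has a pole of order `2` and `y` has a pole of order `3`). -/
def coordVal (E : WeierstrassCurve k) (f : E.toAffine.CoordinateRing) : ℤᵐ⁰ :=
  if f = 0 then 0 else exp ((Algebra.norm k[X] f).natDegree : ℤ)

theorem norm_ne_zero (E : WeierstrassCurve k) {f : E.toAffine.CoordinateRing} (hf : f ≠ 0) :
    Algebra.norm k[X] f ≠ 0 :=
  (Algebra.norm_ne_zero_iff_of_basis (Affine.CoordinateRing.basis E.toAffine)).mpr hf

theorem degree_norm_add_le (E : WeierstrassCurve k) (f g : E.toAffine.CoordinateRing) :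
    (Algebra.norm k[X] (f + g)).degree ≤
      max (Algebra.norm k[X] f).degree (Algebra.norm k[X] g).degree := by
  obtain ⟨p, q, rfl⟩ := Affine.CoordinateRing.exists_smul_basis_eq f
  obtain ⟨r, s, rfl⟩ := Affine.CoordinateRing.exists_smul_basis_eq g
  have key : p • (1 : E.toAffine.CoordinateRing) + q • Affine.CoordinateRing.mk E.toAffine Y +
      (r • 1 + s • Affine.CoordinateRing.mk E.toAffine Y) =
      (p + r) • 1 + (q + s) • Affine.CoordinateRing.mk E.toAffine Y := by
    rw [add_smul, add_smul]; abel
  rw [key]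
  simp only [Affine.CoordinateRing.degree_norm_smul_basis]
  have h1 : 2 • (p + r).degree ≤ max (2 • p.degree) (2 • r.degree) := by
    rcases le_total p.degree r.degree with h | h
    · exact le_max_of_le_right (nsmul_le_nsmul_right ((degree_add_le _ _).trans (by simp [h])) 2)
    · exact le_max_of_le_left (nsmul_le_nsmul_right ((degree_add_le _ _).trans (by simp [h])) 2)
  have h2 : 2 • (q + s).degree + 3 ≤ max (2 • q.degree + 3) (2 • s.degree + 3) := by
    rcases le_total q.degree s.degree with h | h
    · exact le_max_of_le_right (add_le_add_left
        (nsmul_le_nsmul_right ((degree_add_le _ _).trans (by simp [h])) 2) 3)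
    · exact le_max_of_le_left (add_le_add_left
        (nsmul_le_nsmul_right ((degree_add_le _ _).trans (by simp [h])) 2) 3)
  refine max_le (h1.trans ?_) (h2.trans ?_)
  · exact max_le_max (le_max_left _ _) (le_max_left _ _)
  · exact max_le_max (le_max_right _ _) (le_max_right _ _)

theorem coordVal_add_le (E : WeierstrassCurve k) (f g : E.toAffine.CoordinateRing) :
    coordVal E (f + g) ≤ max (coordVal E f) (coordVal E g) := by
  by_cases hf : f = 0
  · simp [hf]
  by_cases hg : g = 0
  · simp [hg]
  by_cases hfg : f + g = 0
  · simp [coordVal, hfg]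
  have h := degree_norm_add_le E f g
  rw [degree_eq_natDegree (norm_ne_zero E hf), degree_eq_natDegree (norm_ne_zero E hg),
    degree_eq_natDegree (norm_ne_zero E hfg)] at h
  simp only [coordVal, hf, hg, hfg, if_false, le_max_iff, exp_le_exp, Nat.cast_le] at h ⊢
  exact h

/-- The valuation of `coordVal` on the coordinate ring. -/
def coordValuation (E : WeierstrassCurve k) : Valuation E.toAffine.CoordinateRing ℤᵐ⁰ where
  toFun := coordVal E
  map_zero' := by simp [coordVal]
  map_one' := by simp [coordVal]
  map_mul' f g := by
    by_cases hf : f = 0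
    · simp [coordVal, hf]
    by_cases hg : g = 0
    · simp [coordVal, hg]
    simp only [coordVal, hf, hg, mul_eq_zero, or_self, if_false, map_mul]
    rw [natDegree_mul (norm_ne_zero E hf) (norm_ne_zero E hg), Nat.cast_add, exp_add]
  map_add_le_max' := coordVal_add_le E

theorem coordValuation_ne_zero (E : WeierstrassCurve k) :
    nonZeroDivisors E.toAffine.CoordinateRing ≤ (coordValuation E).supp.primeCompl := by
  intro f hf hmem
  have h0 : f ≠ 0 := nonZeroDivisors.ne_zero hf
  have : coordVal E f = 0 := hmem
  simp [coordVal, h0] at this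

/-- The (multiplicatively written) valuation of `k(E)` at the point `O` at infinity:
`f` is regular at `O` iff `valO E f ≤ 1`, and `f` has a pole at `O` iff `1 < valO E f`. -/
def valO (E : WeierstrassCurve k) : Valuation (FF E) ℤᵐ⁰ :=
  (coordValuation E).extendToLocalization (coordValuation_ne_zero E) (FF E)

theorem valO_const (E : WeierstrassCurve k) (c : k) : valO E (algebraMap k (FF E) c) ≤ 1 := by
  rw [IsScalarTower.algebraMap_apply k E.toAffine.CoordinateRing (FF E), valO,
    Valuation.extendToLocalization_apply_map_apply]
  change coordVal E _ ≤ 1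
  rw [coordVal]
  split_ifs with h
  · exact zero_le
  · rw [IsScalarTower.algebraMap_apply k k[X] E.toAffine.CoordinateRing,
      Algebra.norm_algebraMap_of_basis (Affine.CoordinateRing.basis E.toAffine)]
    rw [algebraMap_eq, ← C_pow, natDegree_C]
    simp

/-- The points of `E₂` with coordinates in `k(E₁)`, that is, the rational maps from `E₁` to `E₂`
over `k`.  For smooth `E₁` these are exactly the morphisms `E₁ → E₂` over `k`: a morphism `φ`
corresponds to its value `(x ∘ φ, y ∘ φ)` at the generic point of `E₁`, the constant morphism `O`
corresponds to the zero point, and pointwise addition of morphisms is addition in this group. -/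
abbrev Mor (E₁ E₂ : WeierstrassCurve k) := (E₂⁄(FF E₁)).toAffine.Point

/-- A morphism `E₁ → E₂` maps `O` to `O` iff it is constant equal to `O`, or its `x`-coordinate
has a pole at `O`. -/
def MapsOtoO {E₁ E₂ : WeierstrassCurve k} : Mor E₁ E₂ → Prop
  | .zero => True
  | .some x _ _ => 1 < valO E₁ x

section closure

variable {K : Type*} [Field K] (v : Valuation K ℤᵐ⁰)

/-- If `s (s + c)` and `c` are integral then so is `s`. -/
theorem le_one_of_mul {s c : K} (hc : v c ≤ 1) (h : v (s * (s + c)) ≤ 1) : v s ≤ 1 := by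
  by_contra! hs
  have h1 : v (s + c) = v s := v.map_add_eq_of_lt_left (hc.trans_lt hs)
  rw [map_mul, h1] at h
  exact absurd h (not_le.mpr (hs.trans (lt_mul_of_one_lt_right (zero_lt_one.trans hs) hs)))

theorem add_x_integral {a₁ a₂ a₃ a₄ a₆ x₂ y₂ x₃ y₃ : K} (h₁ : v a₁ ≤ 1) (h₂ : v a₂ ≤ 1)
    (h₃ : v a₃ ≤ 1) (h₄ : v a₄ ≤ 1) (h₆ : v a₆ ≤ 1)
    (e₂ : y₂ ^ 2 + a₁ * x₂ * y₂ + a₃ * y₂ = x₂ ^ 3 + a₂ * x₂ ^ 2 + a₄ * x₂ + a₆)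
    (e₃ : y₃ ^ 2 + a₁ * x₃ * y₃ + a₃ * y₃ = x₃ ^ 3 + a₂ * x₃ ^ 2 + a₄ * x₃ + a₆)
    (hx₂ : 1 < v x₂) (hx₃ : v x₃ ≤ 1) :
    v (((y₃ - y₂) / (x₃ - x₂)) ^ 2 + a₁ * ((y₃ - y₂) / (x₃ - x₂)) - a₂ - x₃ - x₂) ≤ 1 := by
  have hx0 : x₂ ≠ 0 := by rintro rfl; simp at hx₂
  set A := v.integer with hA
  change a₁ ∈ A at h₁
  change a₂ ∈ A at h₂
  change a₃ ∈ A at h₃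
  change a₄ ∈ A at h₄
  change a₆ ∈ A at h₆
  change x₃ ∈ A at hx₃
  obtain ⟨t, ht⟩ : ∃ t, t = x₂⁻¹ := ⟨_, rfl⟩
  have hxt : x₂ = t⁻¹ := by simp [ht]
  have ht0 : t ≠ 0 := by rw [ht]; exact inv_ne_zero hx0
  have htv : v t < 1 := by
    rw [ht, map_inv₀]; exact inv_lt_one_of_one_lt₀ hx₂
  have htA : t ∈ A := htv.le
  have hy₃ : y₃ ∈ A := by
    refine le_one_of_mul v (c := a₁ * x₃ + a₃) (A.add_mem (A.mul_mem h₁ hx₃) h₃) ?_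
    have : y₃ * (y₃ + (a₁ * x₃ + a₃)) = x₃ ^ 3 + a₂ * x₃ ^ 2 + a₄ * x₃ + a₆ := by
      rw [← e₃]; ring
    rw [this]
    exact A.add_mem (A.add_mem (A.add_mem (A.pow_mem hx₃ 3) (A.mul_mem h₂ (A.pow_mem hx₃ 2)))
      (A.mul_mem h₄ hx₃)) h₆
  obtain ⟨s, hs⟩ : ∃ s, s = y₂ * t ^ 2 := ⟨_, rfl⟩
  have hys : y₂ = s / t ^ 2 := by rw [hs]; field_simp
  have e : s ^ 2 + a₁ * t * s + a₃ * t ^ 2 * s = t + a₂ * t ^ 2 + a₄ * t ^ 3 + a₆ * t ^ 4 := by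
    rw [hxt, hys] at e₂
    field_simp at e₂
    linear_combination e₂
  have hsA : s ∈ A := by
    refine le_one_of_mul v (c := a₁ * t + a₃ * t ^ 2)
      (A.add_mem (A.mul_mem h₁ htA) (A.mul_mem h₃ (A.pow_mem htA 2))) ?_
    have : s * (s + (a₁ * t + a₃ * t ^ 2)) = t + a₂ * t ^ 2 + a₄ * t ^ 3 + a₆ * t ^ 4 := by
      rw [← e]; ring
    rw [this]
    exact A.add_mem (A.add_mem (A.add_mem htA (A.mul_mem h₂ (A.pow_mem htA 2)))
      (A.mul_mem h₄ (A.pow_mem htA 3))) (A.mul_mem h₆ (A.pow_mem htA 4))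
  have hu : v (x₃ * t - 1) = 1 := by
    have : v (x₃ * t) < 1 := by
      rw [map_mul]; exact (mul_le_of_le_one_left zero_le hx₃).trans_lt htv
    rw [Valuation.map_sub_swap]
    exact v.map_one_sub_of_lt this
  have hu0 : x₃ * t - 1 ≠ 0 := by
    intro h; rw [h] at hu; simp at hu
  have hd0 : x₃ - x₂ ≠ 0 := by
    intro h; apply hu0; rw [sub_eq_zero.mp h, hxt]; field_simp; ring
  have main : ((y₃ - y₂) / (x₃ - x₂)) ^ 2 + a₁ * ((y₃ - y₂) / (x₃ - x₂)) - a₂ - x₃ - x₂ =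
      (a₄ * t + a₆ * t ^ 2 - a₃ * s + y₃ ^ 2 * t ^ 2 - 2 * y₃ * s
        + a₁ * (y₃ * x₃ * t ^ 2 - y₃ * t - s * x₃)
        - a₂ * (x₃ ^ 2 * t ^ 2 - 2 * x₃ * t)
        - x₃ * (x₃ * t - 1) ^ 2 - x₃ ^ 2 * t + 2 * x₃) / (x₃ * t - 1) ^ 2 := by
    have hd : x₃ - x₂ = (x₃ * t - 1) / t := by rw [hxt]; field_simp
    rw [hd, hys, hxt]
    obtain ⟨u, hu'⟩ : ∃ u, u = x₃ * t - 1 := ⟨_, rfl⟩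
    have hx₃u : x₃ = (u + 1) / t := by rw [hu']; field_simp; ring
    rw [← hu'] at hu0 ⊢
    rw [hx₃u]
    field_simp
    linear_combination e
  rw [main, map_div₀, map_pow, hu, one_pow, div_one]
  have h2 : (2 : K) ∈ A := by simp
  have h1 : (1 : K) ∈ A := A.one_mem
  change _ ∈ A
  lift a₁ to A using h₁
  lift a₂ to A using h₂
  lift a₃ to A using h₃
  lift a₄ to A using h₄
  lift a₆ to A using h₆
  lift x₃ to A using hx₃
  lift y₃ to A using hy₃
  lift s to A using hsA
  lift t to A using htA
  exact (a₄ * t + a₆ * t ^ 2 - a₃ * s + y₃ ^ 2 * t ^ 2 - 2 * y₃ * s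
        + a₁ * (y₃ * x₃ * t ^ 2 - y₃ * t - s * x₃)
        - a₂ * (x₃ ^ 2 * t ^ 2 - 2 * x₃ * t)
        - x₃ * (x₃ * t - 1) ^ 2 - x₃ ^ 2 * t + 2 * x₃ : A).2

end closure

theorem MapsOtoO.neg {E₁ E₂ : WeierstrassCurve k} {P : Mor E₁ E₂} (hP : MapsOtoO P) :
    MapsOtoO (-P) := by
  rcases P with _ | ⟨x, y, h⟩
  · trivial
  · exact hP

theorem not_mapsOtoO_add {E₁ E₂ : WeierstrassCurve k} {R Q : Mor E₁ E₂} (hR : ¬ MapsOtoO R)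
    (hQ : MapsOtoO Q) : ¬ MapsOtoO (R + Q) := by
  rcases R with _ | ⟨x₃, y₃, h₃⟩
  · exact absurd trivial hR
  rcases Q with _ | ⟨x₂, y₂, h₂⟩
  · change ¬ MapsOtoO (_ + 0)
    rwa [add_zero]
  have hx₃ : valO E₁ x₃ ≤ 1 := not_lt.mp hR
  have hx₂ : 1 < valO E₁ x₂ := hQ
  have hne : x₃ ≠ x₂ := by rintro rfl; exact absurd hx₂ (not_lt.mpr hx₃)
  rw [Affine.Point.add_of_X_ne hne]
  change ¬ (1 < valO E₁ _)
  rw [not_lt, Affine.slope_of_X_ne hne, Affine.addX]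
  exact add_x_integral (valO E₁) (valO_const E₁ _) (valO_const E₁ _) (valO_const E₁ _)
    (valO_const E₁ _) (valO_const E₁ _) ((Affine.equation_iff _ _).mp h₂.1)
    ((Affine.equation_iff _ _).mp h₃.1) hx₂ hx₃

theorem MapsOtoO.add {E₁ E₂ : WeierstrassCurve k} {P Q : Mor E₁ E₂} (hP : MapsOtoO P)
    (hQ : MapsOtoO Q) : MapsOtoO (P + Q) := by
  by_contra h
  exact not_mapsOtoO_add h hQ.neg (by rwa [add_neg_cancel_right])

/-- The isogenies `E₁ → E₂` over `k`: the morphisms over `k` that map `O` to `O` (among them the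
zero map), with pointwise addition. -/
def isogenies (E₁ E₂ : WeierstrassCurve k) : AddSubgroup (Mor E₁ E₂) where
  carrier := {φ | MapsOtoO φ}
  zero_mem' := trivial
  add_mem' := MapsOtoO.add
  neg_mem' := MapsOtoO.neg

/-- The type of isogenies `E₁ → E₂` over `k`; a commutative group. -/
abbrev Isogeny (E₁ E₂ : WeierstrassCurve k) := ↥(isogenies E₁ E₂)

/-- The degree of a morphism `φ : E₁ → E₂`: it is `0` for the zero map, and otherwise the degree
of the field extension `k(E₁) / φ^* k(E₂)`, where `φ^* k(E₂) = k(x ∘ φ, y ∘ φ)` is the image of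
`k(E₂)` under pull-back. (For an isogeny other than zero this extension is finite.) -/
def degree {E₁ E₂ : WeierstrassCurve k} : Mor E₁ E₂ → ℕ
  | .zero => 0
  | .some x y _ => Module.finrank (IntermediateField.adjoin k ({x, y} : Set (FF E₁))) (FF E₁)

end EllIsog

end

namespace WeierstrassCurve.Affine.Point

variable {F : Type*} [Field F] {W : Affine F}

/-- The map `addSubMap` on a Weierstrass curve in short normal form. -/
theorem eval_addSubMap_of_isShortNF {R : Type*} [CommRing R] (W : WeierstrassCurve R)
    [W.IsShortNF] (s t u : R) :
    (fun i ↦ (W.addSubMap i).eval ![s, t, u]) =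
      ![s ^ 2 - 2 * W.a₄ * s * u - 4 * W.a₆ * t * u + W.a₄ ^ 2 * u ^ 2,
        2 * t * s + 2 * W.a₄ * t * u + 4 * W.a₆ * u ^ 2, t ^ 2 - 4 * s * u] := by
  ext i
  fin_cases i
  · simp [addSubMap]
  · simp [addSubMap]
  · simp [addSubMap]

theorem equation_iff_of_isShortNF [W.IsShortNF] (x y : F) :
    W.Equation x y ↔ y ^ 2 = x ^ 3 + W.a₄ * x + W.a₆ := by
  rw [Affine.equation_iff, a₁_of_isShortNF, a₂_of_isShortNF, a₃_of_isShortNF]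
  simp

variable [DecidableEq F]

theorem exists_eval_addSubMap_self (W : Affine F) [W.IsShortNF] (P : W.Point) :
    ∃ d : F, (fun i ↦ (W.addSubMap i).eval (P.sym2x P)) = d • (P + P).sym2x 0 := by
  rcases P with _ | ⟨x, y, h⟩
  · refine ⟨1, ?_⟩
    simp only [← zero_def, add_zero, sym2x_zero_zero]
    rw [eval_addSubMap_of_isShortNF]
    ext i; fin_cases i <;> simp
  · have e := (equation_iff_of_isShortNF _ _).mp h.1
    by_cases hy : y = W.negY x y
    · rw [add_self_of_Y_eq hy]
      have hy' : 2 * y = 0 := by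
        rw [negY, a₁_of_isShortNF, a₃_of_isShortNF] at hy
        linear_combination hy
      have hy2 : 4 * (x ^ 3 + W.a₄ * x + W.a₆) = 0 := by
        rw [← e]; linear_combination 2 * y * hy'
      rw [sym2x_some_some, eval_addSubMap_of_isShortNF, sym2x_zero_zero]
      refine ⟨(x * x) ^ 2 - 2 * W.a₄ * (x * x) - 4 * W.a₆ * (x + x) + W.a₄ ^ 2, ?_⟩
      ext i
      fin_cases i
      · simp
      · simp; linear_combination hy2
      · simp; ring
    · rw [add_self_of_Y_ne hy, sym2x_some_some, sym2x_some_zero, eval_addSubMap_of_isShortNF,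
        slope_of_Y_ne rfl hy]
      rw [negY, a₁_of_isShortNF, a₃_of_isShortNF] at hy
      simp only [negY, addX, a₁_of_isShortNF, a₂_of_isShortNF, a₃_of_isShortNF]
      have hy' : 2 * y ≠ 0 := fun h ↦ hy (by linear_combination h)
      refine ⟨4 * y ^ 2, ?_⟩
      have hs : (3 * x ^ 2 + 2 * 0 * x + W.a₄ - 0 * y) / (y - (-y - 0 * x - 0)) =
        (3 * x ^ 2 + W.a₄) / (2 * y) := by congr 1 <;> ring
      rw [hs]
      have hm : 4 * y ^ 2 * ((3 * x ^ 2 + W.a₄) / (2 * y)) ^ 2 = (3 * x ^ 2 + W.a₄) ^ 2 := by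
        rw [div_pow, show 4 * y ^ 2 = (2 * y) ^ 2 by ring, mul_div_cancel₀]
        exact pow_ne_zero 2 hy'
      ext i
      fin_cases i
      · simp
        linear_combination -hm + 8 * x * e
      · simp
        linear_combination -4 * e
      · simp; ring

theorem exists_eval_addSubMap (W : Affine F) [W.IsShortNF] (P Q : W.Point) :
    ∃ d : F, (fun i ↦ (W.addSubMap i).eval (P.sym2x Q)) = d • (P + Q).sym2x (P - Q) := by
  by_cases hPQ : P.xRep = Q.xRep
  · rcases eq_or_eq_neg_of_xRep_eq_xRep hPQ with rfl | rfl
    · simpa using exists_eval_addSubMap_self W P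
    · obtain ⟨d, hd⟩ := exists_eval_addSubMap_self W Q
      refine ⟨d, ?_⟩
      rw [sym2x_neg_left, hd, neg_add_cancel, sym2x_comm 0, ← neg_add', sym2x_neg_left]
  rcases P with _ | ⟨x₁, y₁, h₁⟩ <;> rcases Q with _ | ⟨x₂, y₂, h₂⟩
  · exact absurd rfl hPQ
  · refine ⟨1, ?_⟩
    simp only [← zero_def, zero_add, zero_sub, sym2x_zero_some, sym2x_neg_right, sym2x_some_some,
      eval_addSubMap_of_isShortNF]
    ext i; fin_cases i
    · simp; ring
    · simp; ring
    · simp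
  · refine ⟨1, ?_⟩
    simp only [← zero_def, add_zero, sub_zero, sym2x_some_zero, sym2x_some_some,
      eval_addSubMap_of_isShortNF]
    ext i; fin_cases i
    · simp; ring
    · simp; ring
    · simp
  · have hx : x₁ ≠ x₂ := by rintro rfl; exact hPQ rfl
    have e₁ := (equation_iff_of_isShortNF _ _).mp h₁.1
    have e₂ := (equation_iff_of_isShortNF _ _).mp h₂.1
    rw [sub_eq_add_neg, neg_some, add_of_X_ne hx, add_of_X_ne hx, sym2x_some_some,
      sym2x_some_some, eval_addSubMap_of_isShortNF, slope_of_X_ne hx, slope_of_X_ne hx]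
    simp only [negY, addX, a₁_of_isShortNF, a₂_of_isShortNF, a₃_of_isShortNF]
    have hx' : x₁ - x₂ ≠ 0 := sub_ne_zero.mpr hx
    obtain ⟨l, hl⟩ : ∃ l, l = (y₁ - y₂) / (x₁ - x₂) := ⟨_, rfl⟩
    obtain ⟨m, hm⟩ : ∃ m, m = (y₁ - (-y₂ - 0 * x₂ - 0)) / (x₁ - x₂) := ⟨_, rfl⟩
    rw [← hl, ← hm]
    rw [eq_div_iff hx'] at hl hm
    refine ⟨(x₁ - x₂) ^ 2, ?_⟩
    have hl2 : l ^ 2 * (x₁ - x₂) ^ 2 = (y₁ - y₂) ^ 2 := by rw [← mul_pow, hl]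
    have hm2 : m ^ 2 * (x₁ - x₂) ^ 2 = (y₁ + y₂) ^ 2 := by rw [← mul_pow, hm]; ring
    have hlm : l * m * (x₁ - x₂) ^ 2 = y₁ ^ 2 - y₂ ^ 2 := by
      linear_combination (m * (x₁ - x₂)) * hl + (y₁ - y₂) * hm
    have hlm' : l * m * (x₁ - x₂) = x₁ ^ 2 + x₁ * x₂ + x₂ ^ 2 + W.a₄ := by
      apply mul_right_cancel₀ hx'
      linear_combination hlm + e₁ - e₂
    ext i; fin_cases i
    · simp
      linear_combination (-(l * m * (x₁ - x₂)) - (x₁ ^ 2 + x₁ * x₂ + x₂ ^ 2 + W.a₄)) * hlm' +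
        (x₁ + x₂) * hl2 + (x₁ + x₂) * hm2 + 2 * (x₁ + x₂) * e₁ + 2 * (x₁ + x₂) * e₂
    · simp
      linear_combination - hl2 - hm2 - 2 * e₁ - 2 * e₂
    · simp; ring

end WeierstrassCurve.Affine.Point

namespace Polynomial

section AlgClosed

variable {K : Type*} [Field K] [IsAlgClosed K]

theorem isSquare_C_of_isAlgClosed (c : K) : IsSquare (C c) := by
  obtain ⟨z, hz⟩ := IsAlgClosed.exists_pow_nat_eq c (n := 2) two_pos
  exact ⟨C z, by rw [← C_mul, ← sq, hz]⟩

theorem isSquare_of_isCoprime_of_isSquare_mul {a b : K[X]} (h : IsCoprime a b)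
    (hab : IsSquare (a * b)) : IsSquare a := by
  obtain ⟨c, hc⟩ := hab
  obtain ⟨d, u, hd⟩ := exists_associated_pow_of_mul_eq_pow' h (hc.trans (sq c).symm)
  obtain ⟨r, -, hr⟩ := isUnit_iff.mp u.isUnit
  rw [← hd, ← hr]
  exact ((even_two.isSquare_pow d)).mul (isSquare_C_of_isAlgClosed r)

theorem isCoprime_linear_combinations {F : Type*} [Field F] {u v : F[X]} (h : IsCoprime u v)
    {a b c d : F} (hD : a * d - b * c ≠ 0) :
    IsCoprime (C a * u + C b * v) (C c * u + C d * v) := by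
  obtain ⟨r, s, hrs⟩ := h
  refine ⟨C (a * d - b * c)⁻¹ * (r * C d - s * C c), C (a * d - b * c)⁻¹ * (s * C a - r * C b), ?_⟩
  have hD' : (C (a * d - b * c)⁻¹ : F[X]) * (C a * C d - C b * C c) = 1 := by
    rw [← C_mul, ← C_mul, ← C_sub, ← C_mul, inv_mul_cancel₀ hD, C_1]
  linear_combination (C (a * d - b * c)⁻¹ * (C a * C d - C b * C c)) * hrs + hD'

theorem natDegree_linear_combination_le {F : Type*} [Field F] {u v : F[X]} {n : ℕ}
    (hu : u.natDegree ≤ n) (hv : v.natDegree ≤ n) (a b : F) :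
    (C a * u + C b * v).natDegree ≤ n :=
  natDegree_add_le_of_degree_le ((natDegree_C_mul_le _ _).trans hu)
    ((natDegree_C_mul_le _ _).trans hv)

/-- If four members of a pencil of polynomials without common zeros are squares, then the pencil
is constant. -/
theorem natDegree_eq_zero_of_isSquare_pencil (h2 : (2 : K) ≠ 0) (n : ℕ) :
    ∀ {A B : K[X]} {c : K}, IsCoprime A B → A.natDegree ≤ n → B.natDegree ≤ n → c ≠ 0 → c ≠ 1 →
      IsSquare A → IsSquare B → IsSquare (A - B) → IsSquare (A - C c * B) →
      A.natDegree = 0 ∧ B.natDegree = 0 := by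
  induction n using Nat.strong_induction_on with
  | _ n ih =>
    rintro _ _ c hAB hA hB hc0 hc1 ⟨u, rfl⟩ ⟨v, rfl⟩ h1 hc
    rcases Nat.eq_zero_or_pos n with rfl | hn
    · exact ⟨Nat.le_zero.mp hA, Nat.le_zero.mp hB⟩
    rw [← sq, natDegree_pow] at hA hB
    have huv : IsCoprime u v := hAB.of_mul_left_left.of_mul_right_left
    obtain ⟨m, hm⟩ := IsAlgClosed.exists_pow_nat_eq c (n := 2) two_pos
    have hm0 : m ≠ 0 := by rintro rfl; exact hc0 (by rw [← hm]; ring)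
    have hmp : 1 + m ≠ 0 := fun h ↦ hc1 (by rw [← hm]; linear_combination (m - 1) * h)
    have hmm : 1 - m ≠ 0 := fun h ↦ hc1 (by rw [← hm]; linear_combination (-m - 1) * h)
    have key : ∀ z : K, z ≠ 0 → IsSquare (u * u - C (z ^ 2) * (v * v)) →
        IsSquare (C 1 * u + C z * v) ∧ IsSquare (C 1 * u + C (-z) * v) := by
      intro z hz h
      have hco : IsCoprime (C 1 * u + C z * v) (C 1 * u + C (-z) * v) := by
        refine isCoprime_linear_combinations huv fun h ↦ hz ?_
        have : 2 * z = 0 := by linear_combination -h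
        exact (mul_eq_zero.mp this).resolve_left h2
      have e : u * u - C (z ^ 2) * (v * v) = (C 1 * u + C z * v) * (C 1 * u + C (-z) * v) := by
        simp only [map_one, C_pow, C_neg]; ring
      rw [e] at h
      exact ⟨isSquare_of_isCoprime_of_isSquare_mul hco h,
        isSquare_of_isCoprime_of_isSquare_mul hco.symm (by rwa [mul_comm])⟩
    obtain ⟨hp, hq⟩ := key 1 one_ne_zero (by simpa using h1)
    obtain ⟨hr, hs⟩ := key m hm0 (by rwa [hm])
    have hun : u.natDegree ≤ n / 2 := by omega
    have hvn : v.natDegree ≤ n / 2 := by omega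
    have hB' : C (-((1 - m) / (1 + m))) * (C 1 * u + C 1 * v) =
        C (-((1 - m) / (1 + m))) * u + C (-((1 - m) / (1 + m))) * v := by simp; ring
    have key2 := ih (n / 2) (by omega) (A := C 1 * u + C (-1) * v)
      (B := C (-((1 - m) / (1 + m))) * u + C (-((1 - m) / (1 + m))) * v)
      (c := ((1 + m) / (1 - m)) ^ 2)
      (isCoprime_linear_combinations huv (by
        field_simp
        intro h
        have h' := (div_eq_zero_iff.mp h).resolve_right hmp
        exact mul_ne_zero h2 hmm (by linear_combination -h')))
      (natDegree_linear_combination_le hun hvn _ _) (natDegree_linear_combination_le hun hvn _ _)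
      (pow_ne_zero 2 (div_ne_zero hmp hmm))
      (by
        rw [div_pow, ne_eq, div_eq_one_iff_eq (pow_ne_zero 2 hmm)]
        intro h
        exact mul_ne_zero (mul_ne_zero h2 h2) hm0 (by linear_combination h))
      hq (by rw [← hB']; exact (isSquare_C_of_isAlgClosed _).mul hp)
      (by
        have : C 1 * u + C (-1) * v -
            (C (-((1 - m) / (1 + m))) * u + C (-((1 - m) / (1 + m))) * v) =
            C (2 / (1 + m)) * (C 1 * u + C (-m) * v) := by
          have e1 : 1 - -((1 - m) / (1 + m)) = 2 / (1 + m) := by field_simp; ring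
          have e2 : -1 - -((1 - m) / (1 + m)) = 2 / (1 + m) * -m := by field_simp; ring
          calc _ = C (1 - -((1 - m) / (1 + m))) * u + C (-1 - -((1 - m) / (1 + m))) * v := by
                simp only [C_sub]; ring
            _ = _ := by rw [e1, e2, C_mul, C_1]; ring
        rw [this]
        exact (isSquare_C_of_isAlgClosed _).mul hs)
      (by
        have : C 1 * u + C (-1) * v - C (((1 + m) / (1 - m)) ^ 2) *
            (C (-((1 - m) / (1 + m))) * u + C (-((1 - m) / (1 + m))) * v) =
            C (2 / (1 - m)) * (C 1 * u + C m * v) := by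
          have e1 : 1 - ((1 + m) / (1 - m)) ^ 2 * -((1 - m) / (1 + m)) = 2 / (1 - m) := by
            field_simp; ring
          have e2 : -1 - ((1 + m) / (1 - m)) ^ 2 * -((1 - m) / (1 + m)) = 2 / (1 - m) * m := by
            field_simp; ring
          calc _ = C (1 - ((1 + m) / (1 - m)) ^ 2 * -((1 - m) / (1 + m))) * u +
                C (-1 - ((1 + m) / (1 - m)) ^ 2 * -((1 - m) / (1 + m))) * v := by
                simp only [C_sub, C_mul]; ring
            _ = _ := by rw [e1, e2, C_mul, C_1]; ring
        rw [this]
        exact (isSquare_C_of_isAlgClosed _).mul hr)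
    obtain ⟨kA, kB⟩ := key2
    have hw : (1 - m) / (1 + m) ≠ 0 := div_ne_zero hmm hmp
    rw [← hB', natDegree_C_mul (neg_ne_zero.mpr hw)] at kB
    have hu0 : u.natDegree ≤ 0 := by
      have e : u = C (1 / 2) * (C 1 * u + C (-1) * v) + C (1 / 2) * (C 1 * u + C 1 * v) := by
        have : (C (1 / 2) : K[X]) * 2 = 1 := by
          rw [show (2 : K[X]) = C 2 from (map_ofNat C 2).symm, ← C_mul, one_div, inv_mul_cancel₀ h2, C_1]
        simp only [map_one, map_neg]
        linear_combination -u * this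
      rw [e]
      exact natDegree_linear_combination_le kA.le kB.le _ _
    have hv0 : v.natDegree ≤ 0 := by
      have e : v = C (-(1 / 2)) * (C 1 * u + C (-1) * v) + C (1 / 2) * (C 1 * u + C 1 * v) := by
        have : (C (1 / 2) : K[X]) * 2 = 1 := by
          rw [show (2 : K[X]) = C 2 from (map_ofNat C 2).symm, ← C_mul, one_div, inv_mul_cancel₀ h2, C_1]
        simp only [map_one, map_neg]
        linear_combination -v * this
      rw [e]
      exact natDegree_linear_combination_le kA.le kB.le _ _
    rw [← sq, ← sq, natDegree_pow, natDegree_pow]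
    omega

theorem natDegree_eq_zero_of_isSquare_cubic (h2 : (2 : K) ≠ 0) {p q : K[X]} (hpq : IsCoprime p q)
    {e₁ e₂ e₃ : K} (h₁₂ : e₁ ≠ e₂) (h₁₃ : e₁ ≠ e₃) (h₂₃ : e₂ ≠ e₃) (hq : IsSquare q)
    (h : IsSquare ((p - C e₁ * q) * (p - C e₂ * q) * (p - C e₃ * q))) :
    p.natDegree = 0 ∧ q.natDegree = 0 := by
  have hco : ∀ {a b : K}, a ≠ b → IsCoprime (p - C a * q) (p - C b * q) := by
    intro a b hab
    have := isCoprime_linear_combinations hpq (a := 1) (b := -a) (c := 1) (d := -b)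
      (fun h ↦ hab (by linear_combination h))
    simpa [sub_eq_add_neg] using this
  have s₁ : IsSquare (p - C e₁ * q) :=
    isSquare_of_isCoprime_of_isSquare_mul ((hco h₁₂).mul_right (hco h₁₃)) (by rwa [← mul_assoc])
  have s₂ : IsSquare (p - C e₂ * q) :=
    isSquare_of_isCoprime_of_isSquare_mul ((hco h₁₂.symm).mul_right (hco h₂₃))
      (by convert h using 1; ring)
  have s₃ : IsSquare (p - C e₃ * q) :=
    isSquare_of_isCoprime_of_isSquare_mul ((hco h₁₃.symm).mul_right (hco h₂₃.symm))
      (by convert h using 1; ring)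
  have d₁₂ := sub_ne_zero.mpr h₁₂
  have d₁₃ := sub_ne_zero.mpr h₁₃
  have d₂₃ := sub_ne_zero.mpr h₂₃
  obtain ⟨w, hw⟩ : ∃ w, w = (e₁ - e₃) / (e₂ - e₃) := ⟨_, rfl⟩
  have hw0 : w ≠ 0 := hw ▸ div_ne_zero d₁₃ d₂₃
  have hw1 : 1 - w ≠ 0 := by
    rw [hw, one_sub_div d₂₃]
    exact div_ne_zero (fun h ↦ d₁₂ (by linear_combination -h)) d₂₃
  have hwe : w * (e₂ - e₃) = e₁ - e₃ := by rw [hw, div_mul_cancel₀ _ d₂₃]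
  have hB : IsCoprime (p - C e₁ * q) (C w * (p - C e₂ * q)) :=
    (isCoprime_mul_unit_left_right (isUnit_C.mpr hw0.isUnit) _ _).mpr (hco h₁₂)
  have hdeg := natDegree_eq_zero_of_isSquare_pencil h2
    (max (p - C e₁ * q).natDegree (C w * (p - C e₂ * q)).natDegree) (c := w⁻¹)
    hB (le_max_left _ _) (le_max_right _ _) (inv_ne_zero hw0)
    (by
      rw [ne_eq, inv_eq_one]
      rintro rfl
      simp at hw1)
    s₁ ((isSquare_C_of_isAlgClosed _).mul s₂)
    (by
      have : p - C e₁ * q - C w * (p - C e₂ * q) = C (1 - w) * (p - C e₃ * q) := by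
        have := congrArg C hwe
        simp only [C_mul, C_sub] at this
        rw [C_sub, C_1]
        linear_combination q * this
      rw [this]
      exact (isSquare_C_of_isAlgClosed _).mul s₃)
    (by
      have : p - C e₁ * q - C w⁻¹ * (C w * (p - C e₂ * q)) = C (e₂ - e₁) * q := by
        rw [← mul_assoc, ← C_mul, inv_mul_cancel₀ hw0, C_1, C_sub]; ring
      rw [this]
      exact (isSquare_C_of_isAlgClosed _).mul hq)
  rw [natDegree_C_mul hw0] at hdeg
  obtain ⟨k₁, k₂⟩ := hdeg
  have hq0 : q.natDegree ≤ 0 := by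
    have : q = C (-(e₁ - e₂)⁻¹) * (p - C e₁ * q) + C (e₁ - e₂)⁻¹ * (p - C e₂ * q) := by
      have : (C (e₁ - e₂)⁻¹ : K[X]) * (C e₁ - C e₂) = 1 := by
        rw [← C_sub, ← C_mul, inv_mul_cancel₀ d₁₂, C_1]
      rw [C_neg]
      linear_combination -q * this
    rw [this]
    exact natDegree_linear_combination_le k₁.le k₂.le _ _
  refine ⟨Nat.le_zero.mp ?_, Nat.le_zero.mp hq0⟩
  have : p = C 1 * (p - C e₁ * q) + C e₁ * q := by rw [C_1]; ring
  rw [this]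
  exact natDegree_linear_combination_le k₁.le hq0 _ _

end AlgClosed

theorem exists_roots_depressed_cubic {K : Type*} [Field K] [IsAlgClosed K] (a b : K)
    (hΔ : 4 * a ^ 3 + 27 * b ^ 2 ≠ 0) :
    ∃ e₁ e₂ e₃ : K, e₁ ≠ e₂ ∧ e₁ ≠ e₃ ∧ e₂ ≠ e₃ ∧ e₁ + e₂ + e₃ = 0 ∧
      e₁ * e₂ + e₁ * e₃ + e₂ * e₃ = a ∧ e₁ * e₂ * e₃ = -b := by
  obtain ⟨e, he⟩ := IsAlgClosed.exists_root (X ^ 3 + C a * X + C b : K[X]) (by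
    rw [show (X ^ 3 + C a * X + C b : K[X]).degree = 3 by compute_degree!]; decide)
  obtain ⟨f, hf⟩ := IsAlgClosed.exists_root (X ^ 2 + C e * X + C (a + e ^ 2) : K[X]) (by
    rw [show (X ^ 2 + C e * X + C (a + e ^ 2) : K[X]).degree = 2 by compute_degree!]; decide)
  simp only [IsRoot.def, eval_add, eval_mul, eval_pow, eval_X, eval_C] at he hf
  have ha : a = -(f ^ 2 + e * f + e ^ 2) := by linear_combination hf
  have hb : b = e * f * (e + f) := by
    have : b = -(e ^ 3 + a * e) := by linear_combination he
    rw [this, ha]; ring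
  subst ha hb
  refine ⟨e, f, -e - f, ?_, ?_, ?_, by ring, by ring, by ring⟩
  · rintro rfl; exact hΔ (by ring)
  · intro h
    obtain rfl : f = -2 * e := by linear_combination h
    exact hΔ (by ring)
  · intro h
    obtain rfl : e = -2 * f := by linear_combination h
    exact hΔ (by ring)

/-- A curve `y ^ 2 = x ^ 3 + a * x + b` with nonzero discriminant has no nonconstant points over
`k(t)`. -/
theorem natDegree_eq_zero_of_cubic_eq_sq {k : Type*} [Field k] (h2 : (2 : k) ≠ 0) {a b : k}
    (hΔ : 4 * a ^ 3 + 27 * b ^ 2 ≠ 0) {p q r s : k[X]} (hpq : IsCoprime p q) (hrs : IsCoprime r s)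
    (hq0 : q ≠ 0) (hs0 : s ≠ 0)
    (h : r ^ 2 * q ^ 3 = s ^ 2 * (p ^ 3 + C a * p * q ^ 2 + C b * q ^ 3)) :
    p.natDegree = 0 ∧ q.natDegree = 0 := by
  have hf : IsCoprime (q ^ 3) (p ^ 3 + C a * p * q ^ 2 + C b * q ^ 3) := by
    refine IsCoprime.pow_left ?_
    have : IsCoprime q (p ^ 3 + q * (C a * p * q + C b * q ^ 2)) :=
      (IsCoprime.add_mul_left_right_iff).mpr hpq.symm.pow_right
    convert this using 1
    ring
  have hd₁ : q ^ 3 ∣ s ^ 2 := hf.dvd_of_dvd_mul_right ⟨r ^ 2, by rw [← h]; ring⟩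
  have hd₂ : s ^ 2 ∣ q ^ 3 := hrs.symm.pow.dvd_of_dvd_mul_left ⟨_, h⟩
  obtain ⟨u, hu⟩ := associated_of_dvd_dvd hd₂ hd₁
  obtain ⟨c, hc, hcu⟩ := isUnit_iff.mp u.isUnit
  rw [← hcu] at hu
  have hr : r ^ 2 * C c = p ^ 3 + C a * p * q ^ 2 + C b * q ^ 3 := by
    apply mul_left_cancel₀ (pow_ne_zero 2 hs0)
    rw [← h, ← hu]; ring
  let K := AlgebraicClosure k
  let i := algebraMap k K
  have h2K : (2 : K) ≠ 0 := by
    have := (_root_.map_ne_zero i).mpr h2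
    rwa [map_ofNat] at this
  have hΔK : 4 * i a ^ 3 + 27 * i b ^ 2 ≠ 0 := by
    have := (_root_.map_ne_zero i).mpr hΔ
    rwa [map_add, map_mul, map_mul, map_pow, map_pow, map_ofNat, map_ofNat] at this
  obtain ⟨e₁, e₂, e₃, h₁₂, h₁₃, h₂₃, hs, ht, hn⟩ := exists_roots_depressed_cubic (i a) (i b) hΔK
  have hsq : ∀ (g : K[X]) (c : k), IsSquare (g ^ 2 * C (i c)) := fun g c ↦
    (even_two.isSquare_pow g).mul (isSquare_C_of_isAlgClosed _)
  have hq : IsSquare (q.map i) := by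
    have hu' := congrArg (map i) hu
    simp only [Polynomial.map_mul, Polynomial.map_pow, map_C] at hu'
    obtain ⟨w, hw⟩ := hsq (s.map i) c
    rw [hu'] at hw
    have hqi : q.map i ≠ 0 := (Polynomial.map_ne_zero_iff i.injective).mpr hq0
    obtain ⟨z, rfl⟩ : q.map i ∣ w :=
      (UniqueFactorizationMonoid.pow_dvd_pow_iff_dvd two_ne_zero).mp ⟨q.map i, by linear_combination -hw⟩
    refine ⟨z, mul_left_cancel₀ (pow_ne_zero 2 hqi) ?_⟩
    linear_combination hw
  have hcub : IsSquare ((p.map i - C e₁ * q.map i) * (p.map i - C e₂ * q.map i) *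
      (p.map i - C e₃ * q.map i)) := by
    have hr' := congrArg (map i) hr
    simp only [Polynomial.map_mul, Polynomial.map_pow, Polynomial.map_add, map_C] at hr'
    convert hsq (r.map i) c using 1
    rw [hr', ← ht, show i b = -(e₁ * e₂ * e₃) by rw [hn, neg_neg]]
    have hs' := congrArg C hs
    simp only [C_add, C_0] at hs'
    simp only [C_add, C_mul, C_neg]
    linear_combination -((p.map i) ^ 2 * q.map i) * hs'
  have := natDegree_eq_zero_of_isSquare_cubic h2K (hpq.map (mapRingHom i)) h₁₂ h₁₃ h₂₃ hq hcub
  simpa using this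

end Polynomial

noncomputable section

namespace EllIsog

variable {k : Type*} [Field k] (E : WeierstrassCurve k)

/-- The function `y` on a Weierstrass curve. -/
def yFun : FF E := algebraMap E.toAffine.CoordinateRing (FF E) (Affine.CoordinateRing.mk E.toAffine Y)

theorem algebraMap_polynomial_injective : Function.Injective (algebraMap k[X] (FF E)) := by
  rw [IsScalarTower.algebraMap_eq k[X] E.toAffine.CoordinateRing (FF E)]
  exact (IsFractionRing.injective E.toAffine.CoordinateRing (FF E)).comp
    (FaithfulSMul.algebraMap_injective k[X] E.toAffine.CoordinateRing)

theorem algebraMap_smul_basis (p q : k[X]) :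
    algebraMap E.toAffine.CoordinateRing (FF E)
      (p • 1 + q • Affine.CoordinateRing.mk E.toAffine Y) =
      algebraMap k[X] (FF E) p + algebraMap k[X] (FF E) q * yFun E := by
  rw [Algebra.smul_def, Algebra.smul_def, map_add, map_mul, map_mul, map_one, mul_one,
    ← IsScalarTower.algebraMap_apply, ← IsScalarTower.algebraMap_apply, yFun]

theorem yFun_ne_zero : yFun E ≠ 0 := by
  rw [yFun, ne_eq, FaithfulSMul.algebraMap_eq_zero_iff]
  intro h
  have := (Affine.CoordinateRing.smul_basis_eq_zero (W' := E.toAffine) (p := 0) (q := 1)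
    (by rw [h]; simp)).2
  exact one_ne_zero this

theorem valO_algebraMap_polynomial {p : k[X]} (hp : p ≠ 0) :
    valO E (algebraMap k[X] (FF E) p) = exp ((2 * p.natDegree : ℕ) : ℤ) := by
  rw [IsScalarTower.algebraMap_apply k[X] E.toAffine.CoordinateRing (FF E), valO,
    Valuation.extendToLocalization_apply_map_apply]
  change coordVal E _ = _
  rw [coordVal, if_neg ((map_ne_zero_iff _
    (FaithfulSMul.algebraMap_injective k[X] E.toAffine.CoordinateRing)).mpr hp),
    Algebra.norm_algebraMap_of_basis (Affine.CoordinateRing.basis E.toAffine), natDegree_pow,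
    Fintype.card_fin]

section negation

variable [E.IsShortNF]

theorem yFun_sq : yFun E ^ 2 =
    algebraMap k[X] (FF E) (X ^ 3 + C E.a₄ * X + C E.a₆) := by
  have h := Affine.CoordinateRing.smul_basis_mul_Y (W' := E.toAffine) 0 1
  rw [a₁_of_isShortNF, a₂_of_isShortNF, a₃_of_isShortNF] at h
  have h' := congrArg (algebraMap E.toAffine.CoordinateRing (FF E)) h
  rw [map_mul, algebraMap_smul_basis, algebraMap_smul_basis] at h'
  change _ * yFun E = _ at h'
  simp only [map_zero, map_one, zero_add, zero_mul, one_mul, mul_zero, add_zero, sub_zero] at h'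
  rw [sq, h']

theorem polynomial_of_isShortNF :
    E.toAffine.polynomial = Y ^ 2 - C (X ^ 3 + C E.a₄ * X + C E.a₆) := by
  simp [Affine.polynomial]

theorem eval₂_neg_mk_polynomial :
    E.toAffine.polynomial.eval₂ (Algebra.ofId k[X] E.toAffine.CoordinateRing :
      k[X] →+* E.toAffine.CoordinateRing) (-Affine.CoordinateRing.mk E.toAffine Y) = 0 := by
  have h := Affine.CoordinateRing.smul_basis_mul_Y (W' := E.toAffine) 0 1
  rw [a₁_of_isShortNF, a₂_of_isShortNF, a₃_of_isShortNF] at h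
  simp only [map_zero, zero_add, zero_mul, one_mul, mul_zero, add_zero, sub_zero, Algebra.smul_def,
    mul_one, map_one] at h
  refine (congrArg (eval₂ _ _) (polynomial_of_isShortNF E)).trans ?_
  rw [eval₂_sub, eval₂_pow, eval₂_X, eval₂_C, neg_sq, sq, h]
  exact sub_self _

/-- The pull-back `y ↦ -y` under the inversion of the curve, on the coordinate ring. -/
def negCoord : E.toAffine.CoordinateRing →ₐ[k[X]] E.toAffine.CoordinateRing :=
  AdjoinRoot.liftAlgHom E.toAffine.polynomial (Algebra.ofId k[X] E.toAffine.CoordinateRing)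
    (-Affine.CoordinateRing.mk E.toAffine Y) (eval₂_neg_mk_polynomial E)

theorem negCoord_smul_basis (p q : k[X]) :
    negCoord E (p • 1 + q • Affine.CoordinateRing.mk E.toAffine Y) =
      p • 1 + (-q) • Affine.CoordinateRing.mk E.toAffine Y := by
  have : negCoord E (Affine.CoordinateRing.mk E.toAffine Y) =
      -Affine.CoordinateRing.mk E.toAffine Y := by
    rw [negCoord]
    exact AdjoinRoot.liftAlgHom_root E.toAffine.polynomial
      (Algebra.ofId k[X] E.toAffine.CoordinateRing) _ (eval₂_neg_mk_polynomial E)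
  rw [map_add, map_smul, map_smul, map_one, this, smul_neg, neg_smul]

theorem norm_negCoord (f : E.toAffine.CoordinateRing) :
    Algebra.norm k[X] (negCoord E f) = Algebra.norm k[X] f := by
  obtain ⟨p, q, rfl⟩ := Affine.CoordinateRing.exists_smul_basis_eq f
  rw [negCoord_smul_basis, Affine.CoordinateRing.norm_smul_basis,
    Affine.CoordinateRing.norm_smul_basis, a₁_of_isShortNF, a₃_of_isShortNF]
  simp

theorem negCoord_injective : Function.Injective (negCoord E) := by
  rw [injective_iff_map_eq_zero]
  intro f hf
  by_contra h
  apply norm_ne_zero E h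
  rw [← norm_negCoord, hf]
  simpa using Affine.CoordinateRing.norm_smul_basis (W' := E.toAffine) 0 0

theorem algebraMap_negCoord_injective : Function.Injective
    ((IsScalarTower.toAlgHom k E.toAffine.CoordinateRing (FF E)).comp
      ((negCoord E).restrictScalars k)) :=
  (IsFractionRing.injective E.toAffine.CoordinateRing (FF E)).comp (negCoord_injective E)

/-- The pull-back `y ↦ -y` under the inversion of the curve, on the function field. -/
def negFun : FF E →ₐ[k] FF E :=
  IsFractionRing.liftAlgHom (A := E.toAffine.CoordinateRing) (algebraMap_negCoord_injective E)

theorem negFun_algebraMap (f : E.toAffine.CoordinateRing) :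
    negFun E (algebraMap E.toAffine.CoordinateRing (FF E) f) =
      algebraMap E.toAffine.CoordinateRing (FF E) (negCoord E f) := by
  rw [negFun, IsFractionRing.liftAlgHom_apply, IsFractionRing.lift_algebraMap]
  rfl

theorem negFun_polynomial (p : k[X]) :
    negFun E (algebraMap k[X] (FF E) p) = algebraMap k[X] (FF E) p := by
  rw [IsScalarTower.algebraMap_apply k[X] E.toAffine.CoordinateRing (FF E), negFun_algebraMap,
    AlgHom.commutes]

theorem negFun_yFun : negFun E (yFun E) = -yFun E := by
  have h := negCoord_smul_basis E 0 1
  simp only [zero_smul, one_smul, zero_add, neg_smul] at h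
  rw [yFun, negFun_algebraMap, h, map_neg]

theorem exists_mul_eq_add_mul_yFun (f : FF E) :
    ∃ p q d : k[X], d ≠ 0 ∧ f * algebraMap k[X] (FF E) d =
      algebraMap k[X] (FF E) p + algebraMap k[X] (FF E) q * yFun E := by
  obtain ⟨a, b, hb, rfl⟩ := IsFractionRing.div_surjective (A := E.toAffine.CoordinateRing) f
  have hb0 : algebraMap E.toAffine.CoordinateRing (FF E) b ≠ 0 := by
    rw [ne_eq, FaithfulSMul.algebraMap_eq_zero_iff]
    exact nonZeroDivisors.ne_zero hb
  obtain ⟨p, q, rfl⟩ := Affine.CoordinateRing.exists_smul_basis_eq a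
  obtain ⟨r, s, rfl⟩ := Affine.CoordinateRing.exists_smul_basis_eq b
  refine ⟨p * r - q * s * (X ^ 3 + C E.a₄ * X + C E.a₆), q * r - p * s, _,
    norm_ne_zero E (nonZeroDivisors.ne_zero hb), ?_⟩
  rw [Affine.CoordinateRing.norm_smul_basis, a₁_of_isShortNF, a₂_of_isShortNF, a₃_of_isShortNF]
  rw [div_mul_eq_mul_div, div_eq_iff hb0, algebraMap_smul_basis, algebraMap_smul_basis]
  have h := yFun_sq E
  simp only [map_zero, zero_mul, mul_zero, add_zero, sub_zero, map_sub, map_mul, map_pow,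
    map_add] at h ⊢
  generalize algebraMap k[X] (FF E) X ^ 3 + algebraMap k[X] (FF E) (C E.a₄) *
    algebraMap k[X] (FF E) X + algebraMap k[X] (FF E) (C E.a₆) = t at h ⊢
  subst h
  ring

theorem negFun_negFun (f : FF E) : negFun E (negFun E f) = f := by
  obtain ⟨p, q, d, hd, h⟩ := exists_mul_eq_add_mul_yFun E f
  have hd' : algebraMap k[X] (FF E) d ≠ 0 :=
    (map_ne_zero_iff _ (algebraMap_polynomial_injective E)).mpr hd
  apply mul_right_cancel₀ hd'
  have := congrArg (fun f ↦ negFun E (negFun E f)) h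
  simp only [map_mul, map_add, negFun_polynomial, negFun_yFun, map_neg, neg_neg] at this
  rw [this, h]

theorem exists_isCoprime_of_negFun_eq (h2 : (2 : k) ≠ 0) {f : FF E} (hf : negFun E f = f) :
    ∃ p d : k[X], IsCoprime p d ∧ d ≠ 0 ∧
      f * algebraMap k[X] (FF E) d = algebraMap k[X] (FF E) p := by
  obtain ⟨p, q, d, hd, h⟩ := exists_mul_eq_add_mul_yFun E f
  have h' := congrArg (negFun E) h
  simp only [map_mul, map_add, negFun_polynomial, negFun_yFun, hf] at h'
  have h2' : (2 : FF E) ≠ 0 := by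
    have := (_root_.map_ne_zero (algebraMap k (FF E))).mpr h2
    rwa [map_ofNat] at this
  have hq : algebraMap k[X] (FF E) q = 0 := by
    have : 2 * (algebraMap k[X] (FF E) q * yFun E) = 0 := by linear_combination h' - h
    exact (mul_eq_zero.mp ((mul_eq_zero.mp this).resolve_left h2')).resolve_right (yFun_ne_zero E)
  rw [hq, zero_mul, add_zero] at h
  classical
  have hg : EuclideanDomain.gcd p d ≠ 0 := fun h0 ↦ hd (EuclideanDomain.gcd_eq_zero_iff.mp h0).2
  obtain ⟨p', hp'⟩ := EuclideanDomain.gcd_dvd_left p d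
  obtain ⟨d', hd'⟩ := EuclideanDomain.gcd_dvd_right p d
  refine ⟨p', d', ?_, ?_, ?_⟩
  · refine ⟨EuclideanDomain.gcdA p d, EuclideanDomain.gcdB p d, mul_left_cancel₀ hg ?_⟩
    have := EuclideanDomain.gcd_eq_gcd_ab p d
    linear_combination -this - EuclideanDomain.gcdA p d * hp' - EuclideanDomain.gcdB p d * hd'
  · rintro rfl
    exact hd (by rw [hd', mul_zero])
  · have hg' := (map_ne_zero_iff _ (algebraMap_polynomial_injective E)).mpr hg
    apply mul_left_cancel₀ hg'
    rw [← map_mul, ← hp', ← h, mul_left_comm, ← map_mul, ← hd']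

theorem valO_negFun (f : FF E) : valO E (negFun E f) = valO E f := by
  have key : ∀ a : E.toAffine.CoordinateRing,
      valO E (negFun E (algebraMap E.toAffine.CoordinateRing (FF E) a)) =
        valO E (algebraMap E.toAffine.CoordinateRing (FF E) a) := by
    intro a
    rw [negFun_algebraMap, valO, Valuation.extendToLocalization_apply_map_apply,
      Valuation.extendToLocalization_apply_map_apply]
    change coordVal E _ = coordVal E _
    simp only [coordVal, norm_negCoord, map_eq_zero_iff _ (negCoord_injective E)]
  obtain ⟨a, b, -, rfl⟩ := IsFractionRing.div_surjective (A := E.toAffine.CoordinateRing) f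
  rw [map_div₀, map_div₀, map_div₀, key, key]

end negation

section oddness

variable {E₁ E₂ : WeierstrassCurve k}

instance {R S : Type*} [CommRing R] [CommRing S] (f : R →+* S) (W : WeierstrassCurve R)
    [W.IsShortNF] : (W.map f).IsShortNF :=
  ⟨by simp, by simp, by simp⟩

instance {R A : Type*} [CommRing R] [CommRing A] [Algebra R A] (W : WeierstrassCurve R)
    [W.IsShortNF] : (W⁄A).IsShortNF :=
  inferInstanceAs (W.map (algebraMap R A)).IsShortNF

theorem discriminant_ne_zero_of_isShortNF (W : WeierstrassCurve k) [W.IsShortNF] [W.IsElliptic] :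
    4 * W.a₄ ^ 3 + 27 * W.a₆ ^ 2 ≠ 0 := by
  intro h
  apply W.isUnit_Δ.ne_zero
  rw [Δ_of_isShortNF, h, mul_zero]

theorem equation_mor [E₂.IsShortNF] {x y : FF E₁} (h : (E₂⁄(FF E₁)).toAffine.Nonsingular x y) :
    y ^ 2 = x ^ 3 + algebraMap k (FF E₁) E₂.a₄ * x + algebraMap k (FF E₁) E₂.a₆ :=
  (Affine.Point.equation_iff_of_isShortNF (W := E₂⁄(FF E₁)) x y).mp h.1

variable [E₁.IsShortNF]

theorem mapsOtoO_map_negFun {P : Mor E₁ E₂} (hP : MapsOtoO P) :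
    MapsOtoO (Affine.Point.map (W' := E₂.toAffine) (negFun E₁) P : Mor E₁ E₂) := by
  rcases P with _ | ⟨x, y, h⟩
  · trivial
  · change 1 < valO E₁ (negFun E₁ x)
    rw [valO_negFun]
    exact hP

variable [E₂.IsShortNF]

/-- A point of `E₂` over `k(x) ⊆ k(E₁)` has no pole at infinity. -/
theorem valO_le_one_of_negFun_eq [E₂.IsElliptic] (h2 : (2 : k) ≠ 0) {x y : FF E₁}
    (h : (E₂⁄(FF E₁)).toAffine.Nonsingular x y) (hx : negFun E₁ x = x) (hy : negFun E₁ y = y) :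
    valO E₁ x ≤ 1 := by
  obtain ⟨p, q, hpq, hq, hxp⟩ := exists_isCoprime_of_negFun_eq E₁ h2 hx
  obtain ⟨r, s, hrs, hs, hyr⟩ := exists_isCoprime_of_negFun_eq E₁ h2 hy
  have hdeg := natDegree_eq_zero_of_cubic_eq_sq h2 (discriminant_ne_zero_of_isShortNF E₂) hpq hrs
    hq hs (by
      apply algebraMap_polynomial_injective E₁
      have e := equation_mor h
      have hC : ∀ c : k, algebraMap k[X] (FF E₁) (C c) = algebraMap k (FF E₁) c := fun c ↦
        (IsScalarTower.algebraMap_apply k k[X] (FF E₁) c).symm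
      simp only [map_add, map_mul, map_pow, hC]
      rw [← hxp, ← hyr, mul_pow, e]
      ring)
  rcases eq_or_ne p 0 with rfl | hp
  · rw [map_zero, mul_eq_zero, map_eq_zero_iff _ (algebraMap_polynomial_injective E₁)] at hxp
    simp [hxp.resolve_right hq]
  · have := congrArg (valO E₁) hxp
    rw [map_mul, valO_algebraMap_polynomial E₁ hp, valO_algebraMap_polynomial E₁ hq, hdeg.1,
      hdeg.2] at this
    simp only [mul_zero, Nat.cast_zero, exp_zero, mul_one] at this
    exact this.le

theorem map_negFun_eq_neg [E₂.IsElliptic] (h2 : (2 : k) ≠ 0) {P : Mor E₁ E₂} (hP : MapsOtoO P) :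
    Affine.Point.map (W' := E₂.toAffine) (negFun E₁) P = -P := by
  have hO := hP.add (mapsOtoO_map_negFun hP)
  have hfix : Affine.Point.map (W' := E₂.toAffine) (negFun E₁)
      (P + Affine.Point.map (W' := E₂.toAffine) (negFun E₁) P) =
      P + Affine.Point.map (W' := E₂.toAffine) (negFun E₁) P := by
    have hid : (negFun E₁).comp (negFun E₁) = AlgHom.id k (FF E₁) :=
      AlgHom.ext (negFun_negFun E₁)
    have hmap : Affine.Point.map (W' := E₂.toAffine) (AlgHom.id k (FF E₁)) P = P := by
      cases P <;> rfl
    rw [map_add, Affine.Point.map_map, hid, hmap, add_comm]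
  rw [eq_neg_iff_add_eq_zero, add_comm]
  generalize P + Affine.Point.map (W' := E₂.toAffine) (negFun E₁) P = R at hO hfix
  rcases R with _ | ⟨x, y, h⟩
  · rfl
  · exfalso
    rw [Affine.Point.map_some, Affine.Point.some.injEq] at hfix
    exact absurd hO (not_lt.mpr (valO_le_one_of_negFun_eq h2 h hfix.1 hfix.2))

theorem negFun_coordinates [E₂.IsElliptic] (h2 : (2 : k) ≠ 0) {x y : FF E₁}
    {h : (E₂⁄(FF E₁)).toAffine.Nonsingular x y}
    (hP : MapsOtoO (.some x y h : Mor E₁ E₂)) : negFun E₁ x = x ∧ negFun E₁ y = -y := by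
  have := map_negFun_eq_neg h2 hP
  rw [Affine.Point.map_some, Affine.Point.neg_some, Affine.Point.some.injEq, Affine.negY,
    a₁_of_isShortNF (E₂⁄(FF E₁)), a₃_of_isShortNF (E₂⁄(FF E₁))] at this
  simpa using this

end oddness

end EllIsog

end

noncomputable section

open IntermediateField in
/-- An extension generated by a square root on which an automorphism over the base acts as `-1`
is quadratic. -/
theorem finrank_adjoin_eq_two_of_map_eq_neg {k K : Type*} [Field k] [Field K] [Algebra k K]
    (h2 : (2 : K) ≠ 0) (σ : K →ₐ[k] K) (M : IntermediateField k K) (hM : ∀ m ∈ M, σ m = m) {y : K}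
    (hy : σ y = -y) (hy0 : y ≠ 0) (hy2 : y ^ 2 ∈ M) : Module.finrank M M⟮y⟯ = 2 := by
  have hroot : aeval y (X ^ 2 - C (⟨y ^ 2, hy2⟩ : M)) = 0 := by
    rw [map_sub, map_pow, aeval_X, aeval_C]
    exact sub_self _
  have hmonic : (X ^ 2 - C (⟨y ^ 2, hy2⟩ : M)).Monic := monic_X_pow_sub_C _ two_ne_zero
  have hint : IsIntegral M y := ⟨_, hmonic, hroot⟩
  rw [adjoin.finrank hint]
  refine le_antisymm ?_ ((minpoly.two_le_natDegree_iff hint).mpr ?_)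
  · have := natDegree_le_of_dvd (minpoly.dvd M y hroot) hmonic.ne_zero
    rwa [natDegree_X_pow_sub_C] at this
  · rintro ⟨m, hm⟩
    have hym : σ y = y := hM y (hm ▸ m.2)
    rw [hy] at hym
    have : 2 * y = 0 := by linear_combination -hym
    exact (mul_ne_zero h2 hy0) this

namespace RatFunc

theorem natDegree_num_div_of_isCoprime {k : Type*} [Field k] {u v : k[X]} (h : IsCoprime u v)
    (hv : v ≠ 0) :
    (algebraMap k[X] (RatFunc k) u / algebraMap k[X] (RatFunc k) v).num.natDegree = u.natDegree ∧
    (algebraMap k[X] (RatFunc k) u / algebraMap k[X] (RatFunc k) v).denom.natDegree =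
      v.natDegree := by
  set t := algebraMap k[X] (RatFunc k) u / algebraMap k[X] (RatFunc k) v with ht
  have e : u * t.denom = t.num * v := by
    apply RatFunc.algebraMap_injective k
    have hinj := RatFunc.algebraMap_injective k
    have hv' := (map_ne_zero_iff _ hinj).mpr hv
    have hd' := (map_ne_zero_iff _ hinj).mpr t.denom_ne_zero
    rw [map_mul, map_mul, ← div_eq_div_iff hv' hd', RatFunc.num_div_denom]
  have hn := RatFunc.num_div_dvd u hv
  have hd := RatFunc.denom_div_dvd u v
  have hn' := h.dvd_of_dvd_mul_right (e ▸ dvd_mul_right u _ : u ∣ _ * v)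
  have hd' := h.symm.dvd_of_dvd_mul_left (e ▸ dvd_mul_left v _ : v ∣ u * _)
  exact ⟨natDegree_eq_of_degree_eq (degree_eq_degree_of_associated (associated_of_dvd_dvd hn hn')),
    natDegree_eq_of_degree_eq (degree_eq_degree_of_associated (associated_of_dvd_dvd hd hd'))⟩

end RatFunc

namespace EllIsog

open IntermediateField

variable {k : Type*} [Field k]

section xField

variable (E : WeierstrassCurve k)

/-- The embedding of `k(x)` into the function field of a Weierstrass curve. -/
def ratFuncHom : RatFunc k →ₐ[k] FF E :=
  IsFractionRing.liftAlgHom (A := k[X]) (g := IsScalarTower.toAlgHom k k[X] (FF E))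
    (algebraMap_polynomial_injective E)

theorem ratFuncHom_algebraMap (p : k[X]) :
    ratFuncHom E (algebraMap k[X] (RatFunc k) p) = algebraMap k[X] (FF E) p :=
  IsFractionRing.lift_algebraMap (A := k[X]) (algebraMap_polynomial_injective E) p

theorem two_ne_zero_functionField (h2 : (2 : k) ≠ 0) : (2 : FF E) ≠ 0 := by
  have := (_root_.map_ne_zero (algebraMap k (FF E))).mpr h2
  rwa [map_ofNat] at this

variable [E.IsShortNF]

theorem negFun_ratFuncHom (r : RatFunc k) : negFun E (ratFuncHom E r) = ratFuncHom E r := by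
  rw [← RatFunc.num_div_denom r, map_div₀, ratFuncHom_algebraMap, ratFuncHom_algebraMap, map_div₀,
    negFun_polynomial, negFun_polynomial]

theorem finrank_ratFuncHom_fieldRange (h2 : (2 : k) ≠ 0) :
    Module.finrank (ratFuncHom E).fieldRange (FF E) = 2 := by
  have hpoly : ∀ p : k[X], algebraMap k[X] (FF E) p ∈ (ratFuncHom E).fieldRange :=
    fun p ↦ ⟨_, ratFuncHom_algebraMap E p⟩
  have hq := finrank_adjoin_eq_two_of_map_eq_neg (two_ne_zero_functionField E h2) (negFun E)
    (ratFuncHom E).fieldRange (by rintro _ ⟨r, rfl⟩; exact negFun_ratFuncHom E r)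
    (negFun_yFun E) (yFun_ne_zero E) (by rw [yFun_sq]; exact hpoly _)
  have htop : (ratFuncHom E).fieldRange⟮yFun E⟯ = ⊤ := by
    rw [eq_top_iff]
    rintro f -
    obtain ⟨p, q, d, hd, h⟩ := exists_mul_eq_add_mul_yFun E f
    have hd' : algebraMap k[X] (FF E) d ≠ 0 :=
      (map_ne_zero_iff _ (algebraMap_polynomial_injective E)).mpr hd
    have hmem : ∀ p : k[X], algebraMap k[X] (FF E) p ∈ (ratFuncHom E).fieldRange⟮yFun E⟯ :=
      fun p ↦ IntermediateField.algebraMap_mem (ratFuncHom E).fieldRange⟮yFun E⟯ ⟨_, hpoly p⟩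
    rw [← eq_div_iff hd'] at h
    rw [h]
    exact div_mem (add_mem (hmem p) (mul_mem (hmem q) (mem_adjoin_simple_self _ _))) (hmem d)
  rwa [htop, finrank_top'] at hq

/-- The degree of `k(E)` over the subfield generated by a function of `x`. -/
theorem finrank_adjoin_ratFuncHom (h2 : (2 : k) ≠ 0) (r : RatFunc k) :
    Module.finrank k⟮ratFuncHom E r⟯ (FF E) = max r.num.natDegree r.denom.natDegree * 2 := by
  have hmap : k⟮ratFuncHom E r⟯ = (k⟮r⟯).map (ratFuncHom E) := by
    rw [adjoin_map, Set.image_singleton]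
  have htop : (ratFuncHom E).fieldRange = (⊤ : IntermediateField k (RatFunc k)).map (ratFuncHom E) :=
    AlgHom.fieldRange_eq_map _
  have hle : k⟮ratFuncHom E r⟯ ≤ (ratFuncHom E).fieldRange := by
    rw [hmap, htop]
    exact map_mono _ le_top
  rw [← relfinrank_mul_finrank_top hle, finrank_ratFuncHom_fieldRange E h2, hmap, htop,
    relfinrank_map_map, relfinrank_top_right, RatFunc.finrank_eq_max_natDegree]

end xField

variable {E₁ E₂ : WeierstrassCurve k} [E₁.IsShortNF] [E₂.IsShortNF] [E₂.IsElliptic]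

theorem finrank_adjoin_x_eq (h2 : (2 : k) ≠ 0) {x y : FF E₁}
    {h : (E₂⁄(FF E₁)).toAffine.Nonsingular x y} (hP : MapsOtoO (.some x y h : Mor E₁ E₂)) :
    Module.finrank k⟮x⟯ (FF E₁) = 2 * degree (.some x y h : Mor E₁ E₂) := by
  obtain ⟨hx, hy⟩ := negFun_coordinates h2 hP
  have hy0 : y ≠ 0 := by
    rintro rfl
    exact absurd hP (not_lt.mpr (valO_le_one_of_negFun_eq h2 h hx (map_zero _)))
  have hM : ∀ m ∈ k⟮x⟯, negFun E₁ m = m := by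
    intro m hm
    induction hm using adjoin_induction with
    | mem z hz => rwa [Set.mem_singleton_iff.mp hz]
    | algebraMap c => exact AlgHom.commutes _ c
    | add a b _ _ ha hb => rw [map_add, ha, hb]
    | inv a _ ha => rw [map_inv₀, ha]
    | mul a b _ _ ha hb => rw [map_mul, ha, hb]
  have hy2 : y ^ 2 ∈ k⟮x⟯ := by
    rw [equation_mor h]
    have hxm := mem_adjoin_simple_self k x
    exact add_mem (add_mem (pow_mem hxm 3) (mul_mem (IntermediateField.algebraMap_mem _ _) hxm))
      (IntermediateField.algebraMap_mem _ _)
  have hq := finrank_adjoin_eq_two_of_map_eq_neg (two_ne_zero_functionField E₁ h2) (negFun E₁)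
    k⟮x⟯ hM hy hy0 hy2
  rw [← Module.finrank_mul_finrank k⟮x⟯ k⟮x⟯⟮y⟯ (FF E₁), hq]
  congr 1
  change _ = Module.finrank (adjoin k {x, y}) (FF E₁)
  rw [← adjoin_simple_adjoin_simple]
  rfl

/-- The `x`-coordinate of an isogeny is a rational function of `x`, whose numerator has the
degree of the isogeny as its degree. -/
theorem exists_polynomials_xRep (h2 : (2 : k) ≠ 0) (φ : Isogeny E₁ E₂) :
    ∃ u v : k[X], IsCoprime u v ∧ v.degree < u.degree ∧ degree φ.1 = u.natDegree ∧
      ∃ c : FF E₁, c ≠ 0 ∧ algebraMap k[X] (FF E₁) u = c * φ.1.xRep 0 ∧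
        algebraMap k[X] (FF E₁) v = c * φ.1.xRep 1 := by
  obtain ⟨_ | ⟨x, y, h⟩, hφ⟩ := φ
  · refine ⟨1, 0, isCoprime_one_left, by simp, by simp [degree], 1, one_ne_zero, ?_, ?_⟩ <;>
      simp [Affine.Point.xRep]
  · have hP : MapsOtoO (.some x y h : Mor E₁ E₂) := hφ
    obtain ⟨u, v, huv, hv, hx⟩ := exists_isCoprime_of_negFun_eq E₁ h2 (negFun_coordinates h2 hP).1
    have hv' : algebraMap k[X] (FF E₁) v ≠ 0 :=
      (map_ne_zero_iff _ (algebraMap_polynomial_injective E₁)).mpr hv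
    have hx1 : 1 < valO E₁ x := hP
    have hu : u ≠ 0 := by
      rintro rfl
      rw [map_zero, mul_eq_zero] at hx
      rw [hx.resolve_right hv', map_zero] at hx1
      exact absurd hx1 (by simp)
    have hdeg : v.natDegree < u.natDegree := by
      have := congrArg (valO E₁) hx
      rw [map_mul, valO_algebraMap_polynomial E₁ hu, valO_algebraMap_polynomial E₁ hv] at this
      have hlt := lt_mul_of_one_lt_left
        (b := exp ((2 * v.natDegree : ℕ) : ℤ)) exp_pos hx1
      rw [this, exp_lt_exp] at hlt
      omega
    refine ⟨u, v, huv, degree_lt_degree hdeg, ?_, algebraMap k[X] (FF E₁) v, hv', ?_, ?_⟩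
    · have hr : ratFuncHom E₁ (algebraMap k[X] (RatFunc k) u / algebraMap k[X] (RatFunc k) v) = x := by
        rw [map_div₀, ratFuncHom_algebraMap, ratFuncHom_algebraMap, ← hx, mul_div_cancel_right₀ _ hv']
      have h₁ := finrank_adjoin_ratFuncHom E₁ h2
        (algebraMap k[X] (RatFunc k) u / algebraMap k[X] (RatFunc k) v)
      obtain ⟨hn, hd⟩ := RatFunc.natDegree_num_div_of_isCoprime huv hv
      rw [hr, hn, hd, finrank_adjoin_x_eq h2 hP, max_eq_left hdeg.le] at h₁
      change degree (.some x y h : Mor E₁ E₂) = _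
      omega
    · rw [← hx, mul_comm]; rfl
    · exact (mul_one _).symm

end EllIsog

end

theorem dvd_of_span_range_eq_top {R ι : Type*} [CommRing R] [Fintype ι] {f g : ι → R}
    (hf : Ideal.span (Set.range f) = ⊤) (h : ∀ i j, f i * g j = f j * g i) (i : ι) :
    f i ∣ g i := by
  obtain ⟨c, hc⟩ := (Ideal.mem_span_range_iff_exists_fun).mp
    (hf ▸ Submodule.mem_top : (1 : R) ∈ Ideal.span (Set.range f))
  refine ⟨∑ j, c j * g j, ?_⟩
  calc g i = (∑ j, c j * f j) * g i := by rw [hc, one_mul]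
    _ = _ := by
      rw [Finset.sum_mul, Finset.mul_sum]
      exact Finset.sum_congr rfl fun j _ ↦ by linear_combination -(c j) * h i j

/-- The symmetric square of two primitive pairs is primitive. -/
theorem span_sym_eq_top_of_isCoprime {R : Type*} [CommRing R] {u v u' v' : R} (h : IsCoprime u v)
    (h' : IsCoprime u' v') :
    Ideal.span (Set.range ![u * u', u * v' + v * u', v * v']) = ⊤ := by
  by_contra hne
  obtain ⟨M, hM, hle⟩ := Ideal.exists_le_maximal _ hne
  have hMp := hM.isPrime
  have hmem : ∀ i, ![u * u', u * v' + v * u', v * v'] i ∈ M := fun i ↦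
    hle (Ideal.subset_span ⟨i, rfl⟩)
  have h0 : u * u' ∈ M := hmem 0
  have h1 : u * v' + v * u' ∈ M := hmem 1
  have h2 : v * v' ∈ M := hmem 2
  have hnot : ∀ {a b : R}, IsCoprime a b → a ∈ M → b ∉ M := by
    rintro a b ⟨r, s, hrs⟩ ha hb
    exact hMp.ne_top ((Ideal.eq_top_iff_one M).mpr
      (hrs ▸ M.add_mem (M.mul_mem_left r ha) (M.mul_mem_left s hb)))
  rcases hMp.mem_or_mem h0 with hu | hu'
  · have hv := hnot h hu
    have hu' := (hMp.mem_or_mem ((M.add_mem_iff_right (M.mul_mem_right v' hu)).mp h1)).resolve_left hv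
    exact hnot h' hu' ((hMp.mem_or_mem h2).resolve_left hv)
  · have hv' := hnot h' hu'
    have hu := (hMp.mem_or_mem ((M.add_mem_iff_left (M.mul_mem_left v hu')).mp h1)).resolve_right hv'
    exact hnot h hu ((hMp.mem_or_mem h2).resolve_right hv')

theorem WeierstrassCurve.span_addSubMap_eq_top {R : Type*} [CommRing R] (W : WeierstrassCurve R)
    [W.IsElliptic] {x : Fin 3 → R} (hx : Ideal.span (Set.range x) = ⊤) :
    Ideal.span (Set.range fun i ↦ (W.addSubMap i).eval x) = ⊤ := by
  by_contra hne
  obtain ⟨M, hM, hle⟩ := Ideal.exists_le_maximal _ hne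
  refine hM.ne_top (top_le_iff.mp (hx ▸ Ideal.span_le.mpr ?_))
  rintro _ ⟨i, rfl⟩
  refine hM.isPrime.mem_of_pow_mem 4 ?_
  rw [← W.addSubMapCoeff_condition x i]
  exact M.sum_mem fun j _ ↦ M.mul_mem_left _ (hle (Ideal.subset_span ⟨j, rfl⟩))

theorem WeierstrassCurve.eval_addSubMap_smul {R : Type*} [CommRing R] (W : WeierstrassCurve R)
    (c : R) (x : Fin 3 → R) (i : Fin 3) :
    (W.addSubMap i).eval (c • x) = c ^ 2 * (W.addSubMap i).eval x := by
  have h : c • x = fun j ↦ c * x j := rfl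
  rw [h]
  fin_cases i <;> simp [addSubMap] <;> ring

theorem WeierstrassCurve.map_eval_addSubMap {R S : Type*} [CommRing R] [CommRing S] (f : R →+* S)
    (W : WeierstrassCurve R) (x : Fin 3 → R) (i : Fin 3) :
    f ((W.addSubMap i).eval x) = ((W.map f).addSubMap i).eval (fun j ↦ f (x j)) := by
  fin_cases i <;> simp [addSubMap, map_b₂, map_b₄, map_b₆, map_b₈, map_ofNat f]

namespace EllIsog

variable {k : Type*} [Field k]

theorem natDegree_eval_addSubMap_zero (W : WeierstrassCurve k[X]) [W.IsShortNF] {a b : k}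
    (ha : W.a₄ = C a) (hb : W.a₆ = C b) {s t u : k[X]} (ht : t.degree < s.degree)
    (hu : u.degree < s.degree) :
    ((W.addSubMap 0).eval ![s, t, u]).natDegree = 2 * s.natDegree := by
  have hs : s ≠ 0 := by rintro rfl; simp at ht
  have hlt : ∀ (c : k) (p : k[X]), p.degree ≤ s.degree →
      (C c * (p * u)).degree < (s ^ 2).degree := by
    intro c p hp
    have hs2 : (s ^ 2).degree ≠ ⊥ := degree_eq_bot.not.mpr (pow_ne_zero 2 hs)
    rcases eq_or_ne (C c * (p * u)) 0 with h0 | h0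
    · rw [h0, degree_zero]
      exact bot_lt_iff_ne_bot.mpr hs2
    · rw [mul_ne_zero_iff, mul_ne_zero_iff, C_ne_zero] at h0
      obtain ⟨hc, hp0, hu0⟩ := h0
      rw [degree_C_mul hc, degree_mul, sq, degree_mul, degree_eq_natDegree hp0,
        degree_eq_natDegree hu0,
        degree_eq_natDegree hs, ← Nat.cast_add, ← Nat.cast_add, Nat.cast_lt]
      exact add_lt_add_of_le_of_lt (natDegree_le_natDegree hp)
        (natDegree_lt_natDegree hu0 hu)
  have h := congrFun (Affine.Point.eval_addSubMap_of_isShortNF W s t u) 0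
  have e : ((W.addSubMap 0).eval ![s, t, u]) =
      s ^ 2 + (C (-(2 * a)) * (s * u) + C (-(4 * b)) * (t * u) + C (a ^ 2) * (u * u)) := by
    refine h.trans ?_
    simp only [ha, hb, Matrix.cons_val_zero, C_neg, C_mul, C_pow, map_ofNat]
    ring
  rw [e, natDegree_add_eq_left_of_degree_lt, natDegree_pow]
  refine (degree_add_le _ _).trans_lt (max_lt ((degree_add_le _ _).trans_lt (max_lt ?_ ?_)) ?_)
  · exact hlt _ _ le_rfl
  · exact hlt _ _ ht.le
  · exact hlt _ _ hu.le

theorem degree_mul_lt_degree_mul {p q p' q' : k[X]} (h : p.degree < p'.degree)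
    (hq : q.degree ≤ q'.degree) (hq0 : q' ≠ 0) : (p * q).degree < (p' * q').degree := by
  have hp0 : p' ≠ 0 := by rintro rfl; simp at h
  rcases eq_or_ne (p * q) 0 with h0 | h0
  · rw [h0, degree_zero, bot_lt_iff_ne_bot, ne_eq, degree_eq_bot]
    exact mul_ne_zero hp0 hq0
  · rw [mul_ne_zero_iff] at h0
    rw [degree_mul, degree_mul, degree_eq_natDegree h0.1, degree_eq_natDegree h0.2,
      degree_eq_natDegree hp0, degree_eq_natDegree hq0, ← Nat.cast_add, ← Nat.cast_add, Nat.cast_lt]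
    exact add_lt_add_of_lt_of_le (natDegree_lt_natDegree h0.1 h) (natDegree_le_natDegree hq)

end EllIsog

theorem theorem1 {k : Type*} [Field k] (h2 : (2 : k) ≠ 0) (h3 : (3 : k) ≠ 0)
    (E₁ E₂ : WeierstrassCurve k) [E₁.IsShortNF] [E₂.IsShortNF] [E₁.IsElliptic] [E₂.IsElliptic]
    (φ ψ : EllIsog.Isogeny E₁ E₂) :
    EllIsog.degree (φ + ψ : EllIsog.Isogeny E₁ E₂).1
        + EllIsog.degree (φ - ψ : EllIsog.Isogeny E₁ E₂).1 =
      2 * EllIsog.degree φ.1 + 2 * EllIsog.degree ψ.1 := by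
  obtain ⟨u₁, v₁, hc₁, hd₁, e₁, c₁, hc₁0, hu₁, hv₁⟩ :=
    EllIsog.exists_polynomials_xRep h2 φ
  obtain ⟨u₂, v₂, hc₂, hd₂, e₂, c₂, hc₂0, hu₂, hv₂⟩ :=
    EllIsog.exists_polynomials_xRep h2 ψ
  obtain ⟨u₃, v₃, hc₃, hd₃, e₃, c₃, hc₃0, hu₃, hv₃⟩ :=
    EllIsog.exists_polynomials_xRep h2 (φ + ψ)
  obtain ⟨u₄, v₄, hc₄, hd₄, e₄, c₄, hc₄0, hu₄, hv₄⟩ :=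
    EllIsog.exists_polynomials_xRep h2 (φ - ψ)
  have hne : ∀ {p q : k[X]}, p.degree < q.degree → q ≠ 0 := by
    rintro p q h rfl
    simp at h
  obtain ⟨W, hW⟩ : ∃ W, W = E₂.map (C : k →+* k[X]) := ⟨_, rfl⟩
  have : W.IsShortNF := hW ▸ inferInstance
  have : W.IsElliptic := hW ▸ inferInstance
  have hWF : W.map (algebraMap k[X] (EllIsog.FF E₁)) = E₂⁄(EllIsog.FF E₁) := by
    rw [hW, WeierstrassCurve.map_map]
    exact congrArg E₂.map (IsScalarTower.algebraMap_eq k k[X] (EllIsog.FF E₁)).symm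
  set x : Fin 3 → k[X] := ![u₁ * u₂, u₁ * v₂ + v₁ * u₂, v₁ * v₂] with hx
  set g : Fin 3 → k[X] := ![u₃ * u₄, u₃ * v₄ + v₃ * u₄, v₃ * v₄] with hg
  set f : Fin 3 → k[X] := fun i ↦ (W.addSubMap i).eval x with hf
  have hftop : Ideal.span (Set.range f) = ⊤ :=
    W.span_addSubMap_eq_top (span_sym_eq_top_of_isCoprime hc₁ hc₂)
  have hgtop : Ideal.span (Set.range g) = ⊤ := span_sym_eq_top_of_isCoprime hc₃ hc₄
  have hxF : (fun i ↦ algebraMap k[X] (EllIsog.FF E₁) (x i)) =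
      (c₁ * c₂) • Affine.Point.sym2x φ.1 ψ.1 := by
    ext i
    fin_cases i <;> simp [hx, Affine.Point.sym2x, hu₁, hv₁, hu₂, hv₂] <;> ring
  have hgF : (fun i ↦ algebraMap k[X] (EllIsog.FF E₁) (g i)) =
      (c₃ * c₄) • Affine.Point.sym2x (φ + ψ).1 (φ - ψ).1 := by
    ext i
    fin_cases i <;>
      simp only [hg, Affine.Point.sym2x, hu₃, hv₃, hu₄, hv₄, Fin.zero_eta, Fin.mk_one,
        Fin.reduceFinMk, Matrix.cons_val, map_mul, map_add, Pi.smul_apply, smul_eq_mul] <;> ring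
  obtain ⟨d, hd⟩ := Affine.Point.exists_eval_addSubMap (E₂⁄(EllIsog.FF E₁)).toAffine φ.1 ψ.1
  have hfF : ∀ i, algebraMap k[X] (EllIsog.FF E₁) (f i) =
      (c₁ * c₂) ^ 2 * d * Affine.Point.sym2x (φ + ψ).1 (φ - ψ).1 i := by
    intro i
    rw [hf, map_eval_addSubMap, hxF, eval_addSubMap_smul, hWF, mul_assoc]
    exact congrArg _ (congrFun hd i)
  have hprop : ∀ i j, f i * g j = f j * g i := by
    intro i j
    apply EllIsog.algebraMap_polynomial_injective E₁
    have hgi := fun i ↦ congrFun hgF i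
    simp only [Pi.smul_apply, smul_eq_mul] at hgi
    rw [map_mul, map_mul, hfF, hfF, hgi, hgi]
    ring
  have hassoc : Associated (f 0) (g 0) := associated_of_dvd_dvd
    (dvd_of_span_range_eq_top hftop hprop 0)
    (dvd_of_span_range_eq_top hgtop (fun i j ↦ by linear_combination -hprop i j) 0)
  have hdeg := natDegree_eq_of_degree_eq (degree_eq_degree_of_associated hassoc)
  have hf0 : (f 0).natDegree = 2 * (u₁ * u₂).natDegree :=
    EllIsog.natDegree_eval_addSubMap_zero W (a := E₂.a₄) (b := E₂.a₆) (by rw [hW]; rfl) (by rw [hW]; rfl)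
      ((degree_add_le _ _).trans_lt (max_lt
        (by
          rw [mul_comm, mul_comm u₁]
          exact EllIsog.degree_mul_lt_degree_mul hd₂ le_rfl (hne hd₁))
        (EllIsog.degree_mul_lt_degree_mul hd₁ le_rfl (hne hd₂))))
      (EllIsog.degree_mul_lt_degree_mul hd₁ hd₂.le (hne hd₂))
  rw [hf0, natDegree_mul (hne hd₁) (hne hd₂)] at hdeg
  change _ = (u₃ * u₄).natDegree at hdeg
  rw [natDegree_mul (hne hd₃) (hne hd₄)] at hdeg
  omega
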